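/- Ranks of transfiniteness are ordered $0<1<2<\cdots<\vec\omega<\omega$. In a standard transfinite graph of rank $\nu$ (a $\nu$-graph, $1\le\nu\le\omega$) every branch joins $0$-nodes; for $\tau=k+1\le\nu$ with $k\in\mathbb N$ (resp. for $\tau=\omega\le\nu$), the $\tau$-nodes partition the set of $k$-tips (resp. $\vec\omega$-tips), i.e. of equivalence classes of one-ended $k$-paths (resp. $\vec\omega$-paths) that eventually coincide, and each $\tau$-node may contain in addition one exceptional element, a node of lower rank that belongs to no other node; there are no $\vec\omega$-nodes, and there is at least one branch. A $0$-path is a finite, one-ended or endless alternating sequence of distinct $0$-nodes and branches joining them. For $\rho>0$ a $\rho$-path is such an alternating sequence of $\rho$-nodes (terminal nodes may have lower rank) and paths of lower ranks that meet terminally, at least one of the two paths at each inner node doing so through a tip of that node, with no repetitions (for $\rho=\vec\omega$ the nodes have natural ranks that increase strictly in each infinite direction); a $\rho$-loop is a closed two-ended $\rho$-path. A standard resistive $\nu$-network is a $\nu$-graph with, in each branch $b$, a resistance $r_b>0$ in series with a voltage source $e_b\in\mathbb R$ (possibly $0$). Its solution space $\mathcal L$ is the closure, in the Hilbert space $\{i:\sum_b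 r_b i_b^2<\infty\}$ with inner product $\sum_b r_b i_b s_b$, of the span of those loop currents around loops of ranks $\rho\le\nu$ that belong to this Hilbert space. Let $\mathcal F$ be a nonprincipal ultrafilter on $\mathbb N$, let $1\le\nu\le\omega$, and let $\langle {\bf N}_n^\nu : n\in\mathbb N\rangle$ be a sequence of standard resistive $\nu$-networks with branch sets $B_n$, resistances $r_{n,b}$, sources $e_{n,b}$ and solution spaces $\mathcal L_n$, such that the total isolated power is finite for almost all $n$: $$\Bigl\{n:\ \sum_{b\in B_n} e_{n,b}^2/r_{n,b}<\infty\Bigr\}\in\mathcal F .$$ Let ${}^*{\bf N}^\nu$ be the induced nonstandard network: its nonstandard branches are the ${\bf b}=[b_n]$ with $b_n\in B_n$, with hyperreal resistances ${\bf r}_{\bf b}=[r_{n,b_n}]$ and sources ${\bf e}_{\bf b}=[e_{n,b_n}]$, and its solution space ${}^*\mathcal L$ consists of the hyperreal branch vectors ${\bf b}\mapsto[i_{n,b_n}]$ induced by sequences $\langle i_n\rangle$ with $i_n\in\mathcal L_n$ for almost all $n$. Then ${}^*{\bf N}^\nu$ has exactly one hyperreal operating point: there is exactly one pair $({\bf i},{\bf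 v})$ of hyperreal branch currents ${\bf i}=({\bf i}_{\bf b})\in{}^*\mathcal L$ and hyperreal branch voltages ${\bf v}=({\bf v}_{\bf b})$ such that Ohm's law ${\bf v}_{\bf b}={\bf r}_{\bf b}{\bf i}_{\bf b}-{\bf e}_{\bf b}$ holds in every nonstandard branch ${\bf b}$ and Tellegen's equation $$\sum_{\bf b}{\bf v}_{\bf b}{\bf s}_{\bf b}=0$$ holds for every ${\bf s}\in{}^*\mathcal L$. Here the sum of a vector ${\bf b}\mapsto[w_{n,b_n}]$ is $\bigl[\sum_{b\in B_n}w_{n,b}\bigr]$, where it is part of the assertion that for almost all $n$ the series converges absolutely. -/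

import Mathlib

/-! Transfinite graphs and resistive networks of ranks up to `ω`, and the nonstandard networks
induced by sequences of them. -/

universe u v

/-- The ranks of transfiniteness up to `ω`, in their order `0 < 1 < 2 < ⋯ < ω⃗ < ω`: the natural
numbers, then the arrow rank `ω⃗` (which is `Rank.arrow`), then `ω` (which is `⊤`).
The covering relation `σ ⋖ τ` says that either `σ = k` and `τ = k + 1` with `k` natural, or
`σ = ω⃗` and `τ = ω`; so it says that `τ`-nodes are made of `σ`-tips. -/
abbrev Rank : Type := WithTop ℕ∞

/-- The arrow rank `ω⃗`. -/
def Rank.arrow : Rank := ((⊤ : ℕ∞) : Rank)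

/-- What a directed path runs through: its branches, each with the direction in which it is
traversed (`(b, true)` along the reference direction of `b`, `(b, false)` against it), and all the
nodes of all ranks that occur in it. -/
structure Track (X : Type v) (B : Type u) where
  darts : Set (B × Bool)
  nodes : Set X

namespace Track

/-- The same path, traversed in the opposite direction. -/
def reverse {X : Type v} {B : Type u} (S : Track X B) : Track X B where
  darts := {d | (d.1, !d.2) ∈ S.darts}
  nodes := S.nodes

/-- A single branch traversed in a given direction. -/
def single {X : Type v} {B : Type u} (d : B × Bool) : Track X B where
  darts := {d}
  nodes := ∅

end Track

/-- A one-way infinite alternating sequence `x₀, P₀, x₁, P₁, …` of nodes and pieces. -/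
structure Ray (X : Type v) (B : Type u) where
  node : ℕ → X
  piece : ℕ → Track X B

namespace Ray

/-- The directed branches of the pieces `P_m, P_{m+1}, …`. -/
def tail {X : Type v} {B : Type u} (R : Ray X B) (m : ℕ) : Set (B × Bool) :=
  {d | ∃ j, m ≤ j ∧ d ∈ (R.piece j).darts}

/-- Two one-ended sequences are equivalent if they eventually run along the same route, that is,
every tail of either one contains a tail of the other. -/
instance setoid (X : Type v) (B : Type u) : Setoid (Ray X B) where
  r R R' := (∀ m, ∃ m', R'.tail m' ⊆ R.tail m) ∧ (∀ m, ∃ m', R.tail m' ⊆ R'.tail m)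
  iseqv :=
    { refl := fun _ => ⟨fun m => ⟨m, subset_rfl⟩, fun m => ⟨m, subset_rfl⟩⟩
      symm := fun h => ⟨h.2, h.1⟩
      trans := by
        intro R S T h k
        refine ⟨fun m => ?_, fun m => ?_⟩
        · obtain ⟨p, hp⟩ := h.1 m
          obtain ⟨q, hq⟩ := k.1 p
          exact ⟨q, hq.trans hp⟩
        · obtain ⟨p, hp⟩ := k.2 m
          obtain ⟨q, hq⟩ := h.2 p
          exact ⟨q, hq.trans hp⟩ }

end Ray

/-- Equivalence classes of one-ended sequences. The tips of a graph are the classes of its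
one-ended paths, see `PreGraph.IsTip`. -/
abbrev TipClass (X : Type v) (B : Type u) : Type (max u v) := Quotient (Ray.setoid X B)

/-- An alternating sequence `…, x_i, P_i, x_{i+1}, P_{i+1}, …` of nodes and pieces, where the pieces
are indexed by `idx` (so that the nodes are indexed by `idx` and `idx + 1`). Only the values at these
indices matter. -/
structure Chain (X : Type v) (B : Type u) where
  idx : Set ℤ
  node : ℤ → X
  piece : ℤ → Track X B

namespace Chain

variable {X : Type v} {B : Type u}

/-- Everything that the sequence runs through. -/
def track (C : Chain X B) : Track X B where
  darts := {d | ∃ i ∈ C.idx, d ∈ (C.piece i).darts}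
  nodes := {x | ∃ i ∈ C.idx, x = C.node i ∨ x = C.node (i + 1) ∨ x ∈ (C.piece i).nodes}

/-- `u` is the first node of the sequence (there is one only if the sequence starts somewhere). -/
def IsFirst (C : Chain X B) (u : X) : Prop := ∃ m, IsLeast C.idx m ∧ C.node m = u

/-- `u` is the last node of the sequence (there is one only if the sequence stops somewhere). -/
def IsLast (C : Chain X B) (u : X) : Prop := ∃ m, IsGreatest C.idx m ∧ C.node (m + 1) = u

/-- The sequence `x_m, P_m, x_{m+1}, P_{m+1}, …`. -/
def forwardRay (C : Chain X B) (m : ℤ) : Ray X B where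
  node j := C.node (m + j)
  piece j := C.piece (m + j)

/-- The sequence `x_{m+1}, P_m, x_m, P_{m-1}, …`, with every piece traversed backwards. -/
def backwardRay (C : Chain X B) (m : ℤ) : Ray X B where
  node j := C.node (m + 1 - j)
  piece j := (C.piece (m - j)).reverse

/-- The sequence extends infinitely to the left, and `t` is its tip there. -/
def StartTip (C : Chain X B) (t : TipClass X B) : Prop :=
  ¬ BddBelow C.idx ∧ ∃ m ∈ C.idx, t = Quotient.mk _ (C.backwardRay m)

/-- The sequence extends infinitely to the right, and `t` is its tip there. -/
def EndTip (C : Chain X B) (t : TipClass X B) : Prop :=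
  ¬ BddAbove C.idx ∧ ∃ m ∈ C.idx, t = Quotient.mk _ (C.forwardRay m)

end Chain

/-- The data of a transfinite graph: the branches, with their two `0`-nodes (first and second with
respect to a reference direction), the nodes of all ranks, and for each node the set of tips it
contains and its exceptional element, if there is one. -/
structure PreGraph where
  Branch : Type u
  Node : Type v
  rank : Node → Rank
  source : Branch → Node
  target : Branch → Node
  tips : Node → Set (TipClass Node Branch)
  exc : Node → Option Node

namespace PreGraph

variable (G : PreGraph.{u, v})

/-- The nodes embraced by `x`: `x` itself, its exceptional element, the exceptional element of
that node, and so on. -/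
def embraced (x : G.Node) : Set G.Node :=
  {y | Relation.ReflTransGen (fun p q => G.exc p = some q) x y}

/-- The nodes embraced by a path. -/
def trackEmbraced (S : Track G.Node G.Branch) : Set G.Node :=
  {y | ∃ x ∈ S.nodes, y ∈ G.embraced x}

/-- The node at which a directed branch starts. -/
def dartSource (d : G.Branch × Bool) : G.Node := if d.2 then G.source d.1 else G.target d.1

/-- The node at which a directed branch ends. -/
def dartTarget (d : G.Branch × Bool) : G.Node := if d.2 then G.target d.1 else G.source d.1

/-- The path `C` reaches `x` at its start through a tip that is a member of `x`. -/
def StartsByTip (C : Chain G.Node G.Branch) (x : G.Node) : Prop := ∃ t ∈ G.tips x, C.StartTip t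

/-- The path `C` reaches `x` at its end through a tip that is a member of `x`. -/
def EndsByTip (C : Chain G.Node G.Branch) (x : G.Node) : Prop := ∃ t ∈ G.tips x, C.EndTip t

/-- The path `C` meets `x` at its start: its first node is embraced by `x`, or its tip there is a
member of a node embraced by `x`. -/
def MeetsStart (C : Chain G.Node G.Branch) (x : G.Node) : Prop :=
  (∃ y ∈ G.embraced x, C.IsFirst y) ∨ (∃ y ∈ G.embraced x, G.StartsByTip C y)

/-- The path `C` meets `x` at its end. -/
def MeetsEnd (C : Chain G.Node G.Branch) (x : G.Node) : Prop :=
  (∃ y ∈ G.embraced x, C.IsLast y) ∨ (∃ y ∈ G.embraced x, G.EndsByTip C y)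

/-- The conditions, common to all paths and loops of positive rank, on the nodes `x i` and the
paths `D i` of an alternating sequence. The paths are indexed by `I`, and `D i` leads from `x i` to
`x (next i)`: for paths `next i = i + 1`, for loops `next` is cyclic. The indices in `inner` are
those of the nodes that are not terminal. -/
structure Linked (I : Set ℤ) (next : ℤ → ℤ) (inner : Set ℤ) (x : ℤ → G.Node)
    (D : ℤ → Chain G.Node G.Branch) : Prop where
  /-- Every path meets the two nodes next to it terminally. -/
  meets_start : ∀ i ∈ I, G.MeetsStart (D i) (x i)
  meets_end : ∀ i ∈ I, G.MeetsEnd (D i) (x (next i))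
  /-- At least one of the two paths at an inner node `x` reaches it through a tip in `x`. -/
  junction : ∀ i ∈ I, next i ∈ inner →
    G.EndsByTip (D i) (x (next i)) ∨ G.StartsByTip (D (next i)) (x (next i))
  /-- Some path reaches a node next to it through a tip in that node. -/
  some_tip : ∃ i ∈ I, G.StartsByTip (D i) (x i) ∨ G.EndsByTip (D i) (x (next i))
  /-- Different nodes of the sequence embrace no common node. -/
  node_node : ∀ a ∈ I ∪ next '' I, ∀ b ∈ I ∪ next '' I, a ≠ b →
    Disjoint (G.embraced (x a)) (G.embraced (x b))
  /-- A node and a path of the sequence have nothing in common, except that they may meet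
  terminally if they are adjacent. -/
  node_path : ∀ a ∈ I ∪ next '' I, ∀ i ∈ I,
    ∀ y ∈ G.embraced (x a) ∩ G.trackEmbraced (D i).track,
      (a = i ∧ ∃ w, (D i).IsFirst w ∧ y ∈ G.embraced w) ∨
      (a = next i ∧ ∃ w, (D i).IsLast w ∧ y ∈ G.embraced w)
  /-- Different paths of the sequence have no node in common, except that they may meet terminally
  in a node of the sequence that is adjacent to both. -/
  path_path : ∀ i ∈ I, ∀ j ∈ I, i ≠ j →
    ∀ y ∈ G.trackEmbraced (D i).track ∩ G.trackEmbraced (D j).track,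
      ∃ a, (a = i ∨ a = next i) ∧ (a = j ∨ a = next j) ∧ y ∈ G.embraced (x a)
  /-- No branch is repeated. -/
  branch_branch : ∀ i ∈ I, ∀ j ∈ I, i ≠ j → ∀ b s s',
    (b, s) ∈ (D i).track.darts → (b, s') ∉ (D j).track.darts

/-- `G.IsPath ρ C`: the alternating sequence `C` is a (nontrivial, directed) `ρ`-path. It is
two-ended, one-ended or endless according to whether `C.idx` is bounded on both sides, on one side
or on no side. -/
inductive IsPath : Rank → Chain G.Node G.Branch → Prop
  /-- A `0`-path is an alternating sequence of different `0`-nodes and branches that connect them. -/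
  | zero (C : Chain G.Node G.Branch) (d : ℤ → G.Branch × Bool)
      (nonempty : C.idx.Nonempty) (interval : C.idx.OrdConnected)
      (piece : ∀ i ∈ C.idx, C.piece i = Track.single (d i))
      (src : ∀ i ∈ C.idx, G.dartSource (d i) = C.node i)
      (tgt : ∀ i ∈ C.idx, G.dartTarget (d i) = C.node (i + 1))
      (inj : Set.InjOn C.node (C.idx ∪ (· + 1) '' C.idx)) :
      IsPath 0 C
  /-- A `ρ`-path, where `ρ` is a positive natural number or `ω`, is an alternating sequence of
  `ρ`-nodes and paths of lower ranks; its terminal nodes may have ranks lower than `ρ`. -/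
  | pos (ρ : Rank) (C : Chain G.Node G.Branch) (D : ℤ → Chain G.Node G.Branch) (α : ℤ → Rank)
      (ne_zero : ρ ≠ 0) (ne_arrow : ρ ≠ Rank.arrow)
      (nonempty : C.idx.Nonempty) (interval : C.idx.OrdConnected)
      (lower : ∀ i ∈ C.idx, α i < ρ)
      (path : ∀ i ∈ C.idx, IsPath (α i) (D i))
      (piece : ∀ i ∈ C.idx, C.piece i = (D i).track)
      (linked : G.Linked C.idx (· + 1) C.idx C.node D)
      (rank_inner : ∀ i ∈ C.idx, i + 1 ∈ C.idx → G.rank (C.node (i + 1)) = ρ)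
      (rank_le : ∀ i ∈ C.idx ∪ (· + 1) '' C.idx, G.rank (C.node i) ≤ ρ) :
      IsPath ρ C
  /-- An `ω⃗`-path is a one-ended or endless alternating sequence of nodes and paths of natural
  ranks, such that the ranks of the nodes increase strictly in each infinite direction, from some
  index `c` on. -/
  | arrow (C : Chain G.Node G.Branch) (D : ℤ → Chain G.Node G.Branch) (α : ℤ → Rank) (c : ℤ)
      (nonempty : C.idx.Nonempty) (interval : C.idx.OrdConnected)
      (infinite : ¬ (BddBelow C.idx ∧ BddAbove C.idx))
      (lower : ∀ i ∈ C.idx, α i < Rank.arrow)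
      (path : ∀ i ∈ C.idx, IsPath (α i) (D i))
      (piece : ∀ i ∈ C.idx, C.piece i = (D i).track)
      (linked : G.Linked C.idx (· + 1) C.idx C.node D)
      (rank_lt : ∀ i ∈ C.idx ∪ (· + 1) '' C.idx, G.rank (C.node i) < Rank.arrow)
      (right : ∀ i ∈ C.idx, c ≤ i → G.rank (C.node i) < G.rank (C.node (i + 1)))
      (left : ∀ i ∈ C.idx, i + 1 ≤ c → G.rank (C.node (i + 1)) < G.rank (C.node i)) :
      IsPath Rank.arrow C

/-- The `σ`-tips of `G`: the equivalence classes of its one-ended `σ`-paths. -/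
def IsTip (σ : Rank) (t : TipClass G.Node G.Branch) : Prop :=
  ∃ C : Chain G.Node G.Branch,
    G.IsPath σ C ∧ C.idx = Set.Ici 0 ∧ t = Quotient.mk _ (C.forwardRay 0)

/-- `G.IsLoop ρ S`: the directed branches in `S` are those of a directed `ρ`-loop. A `ρ`-loop is
defined like a two-ended `ρ`-path, except that its two terminal nodes coincide: the sequence is
`x 0, P 0, x 1, …, x (n - 1), P (n - 1), x 0`. -/
inductive IsLoop : Rank → Set (G.Branch × Bool) → Prop
  | zero (n : ℕ) (x : ℤ → G.Node) (d : ℤ → G.Branch × Bool)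
      (n_pos : 0 < n)
      (src : ∀ i ∈ Set.Ico (0 : ℤ) n, G.dartSource (d i) = x i)
      (tgt : ∀ i ∈ Set.Ico (0 : ℤ) n, G.dartTarget (d i) = x ((i + 1) % n))
      (inj : Set.InjOn x (Set.Ico (0 : ℤ) n))
      (inj_branch : Set.InjOn (fun i => (d i).1) (Set.Ico (0 : ℤ) n)) :
      IsLoop 0 (d '' Set.Ico (0 : ℤ) n)
  | pos (ρ : Rank) (n : ℕ) (x : ℤ → G.Node) (D : ℤ → Chain G.Node G.Branch) (α : ℤ → Rank)
      (ne_zero : ρ ≠ 0) (ne_arrow : ρ ≠ Rank.arrow) (n_pos : 0 < n)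
      (lower : ∀ i ∈ Set.Ico (0 : ℤ) n, α i < ρ)
      (path : ∀ i ∈ Set.Ico (0 : ℤ) n, G.IsPath (α i) (D i))
      (linked : G.Linked (Set.Ico (0 : ℤ) n) (fun i => (i + 1) % n) (Set.Ioo (0 : ℤ) n) x D)
      (rank_inner : ∀ i ∈ Set.Ioo (0 : ℤ) n, G.rank (x i) = ρ)
      (rank_le : G.rank (x 0) ≤ ρ) :
      IsLoop ρ {d | ∃ i ∈ Set.Ico (0 : ℤ) n, d ∈ (D i).track.darts}

end PreGraph

/-- A standard transfinite graph of rank `ν`, where `ν` is a natural number, `ω⃗` or `ω`. Parallel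
branches are allowed, and so are ranks `τ ≤ ν` without `τ`-nodes (if there are no tips that could
form such nodes). -/
structure TransfiniteGraph (ν : Rank) extends PreGraph.{u, v} where
  branch_nonempty : Nonempty Branch
  rank_le : ∀ x, rank x ≤ ν
  /-- There are no `ω⃗`-nodes. -/
  rank_ne_arrow : ∀ x, rank x ≠ Rank.arrow
  /-- Every branch is incident to two `0`-nodes. -/
  rank_source : ∀ b, rank (source b) = 0
  rank_target : ∀ b, rank (target b) = 0
  /-- The nodes of rank `τ` partition the set of `σ`-tips, where `σ ⋖ τ`. -/
  isTip : ∀ x, ∀ t ∈ tips x, ∃ σ, σ ⋖ rank x ∧ toPreGraph.IsTip σ t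
  tips_nonempty : ∀ x, rank x ≠ 0 → (tips x).Nonempty
  partition : ∀ σ τ, σ ⋖ τ → τ ≤ ν → ∀ t, toPreGraph.IsTip σ t → ∃! x, rank x = τ ∧ t ∈ tips x
  /-- The exceptional element of a node is a node of lower rank, and it is not the exceptional
  element of any other node. -/
  rank_exc : ∀ x y, exc x = some y → rank y < rank x
  exc_inj : ∀ x x' y, exc x = some y → exc x' = some y → x = x'

/-- A standard resistive network of rank `ν`: every branch `b` carries a resistance `r b > 0` in
series with a voltage source `e b` (which is `0` if there is no source in `b`). -/
structure Network (ν : Rank) extends TransfiniteGraph.{u, v} ν where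
  r : Branch → ℝ
  r_pos : ∀ b, 0 < r b
  e : Branch → ℝ

namespace Network

variable {ν : Rank} (N : Network.{u, v} ν)

/-- The unit current around a directed loop. -/
noncomputable def loopCurrent (S : Set (N.Branch × Bool)) : N.Branch → ℝ :=
  S.indicator 1 ∘ (fun b => (b, true)) - S.indicator 1 ∘ (fun b => (b, false))

/-- The space of current vectors `i` with finite total dissipated power `∑ r_b i_b²`. -/
def finitePower : Set (N.Branch → ℝ) := {i | Summable fun b => N.r b * i b ^ 2}

/-- The span of the currents of finite power around loops of ranks up to `ν`. -/
def loopSpan : Submodule ℝ (N.Branch → ℝ) :=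
  Submodule.span ℝ
    {i | i ∈ N.finitePower ∧ ∃ ρ ≤ ν, ∃ S, N.IsLoop ρ S ∧ i = N.loopCurrent S}

/-- The solution space `𝓛`: the closure of the span of the loop currents in the Hilbert space of
current vectors of finite power, with the norm `(∑ r_b i_b²)^(1/2)`. -/
def solutionSpace : Set (N.Branch → ℝ) :=
  {i | i ∈ N.finitePower ∧ ∀ ε > 0, ∃ j ∈ N.loopSpan, ∑' b, N.r b * (i b - j b) ^ 2 < ε}

end Network

/-- The hyperreals, with respect to the ultrafilter `F`. -/
abbrev HyperR (F : Ultrafilter ℕ) : Type := Filter.Germ (F : Filter ℕ) ℝ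

namespace NonstandardNetwork

variable (F : Ultrafilter ℕ) {ν : Rank} (N : ℕ → Network.{u, v} ν)

/-- The nonstandard branches `[b_n]` of the nonstandard network induced by `N`: the sequences of
branches of the `N n`, modulo equality for almost all `n`. -/
abbrev Branch : Type u := (F : Filter ℕ).Product fun n => (N n).Branch

/-- The hyperreal branch vector `[b_n] ↦ [f_n(b_n)]` induced by a sequence of real ones. -/
def induced (f : ∀ n, (N n).Branch → ℝ) : Branch F N → HyperR F :=
  Quotient.lift (fun b => (((fun n => f n (b n)) : ℕ → ℝ) : HyperR F)) fun _ _ h =>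
    Filter.Germ.coe_eq.2 (Filter.Eventually.mono h fun n hn => congrArg (f n) hn)

/-- The hyperreal branch resistances. -/
def r : Branch F N → HyperR F := induced F N fun n => (N n).r

/-- The hyperreal branch voltage sources. -/
def e : Branch F N → HyperR F := induced F N fun n => (N n).e

/-- The nonstandard solution space `*𝓛`. -/
def solutionSpace : Set (Branch F N → HyperR F) :=
  {i | ∃ f : ∀ n, (N n).Branch → ℝ,
    (∀ᶠ n in (F : Filter ℕ), f n ∈ (N n).solutionSpace) ∧ i = induced F N f}

/-- The hyperreal `a` is the sum of the hyperreal branch vector `w` over all nonstandard branches: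
`w = [w_n]` and `a = [a_n]`, where for almost all `n` the series of the `w_n(b)` over the branches
`b` of `N n` converges unconditionally and has the sum `a_n`. -/
def HasSum (w : Branch F N → HyperR F) (a : HyperR F) : Prop :=
  ∃ (f : ∀ n, (N n).Branch → ℝ) (s : ℕ → ℝ),
    w = induced F N f ∧ a = (s : HyperR F) ∧ ∀ᶠ n in (F : Filter ℕ), _root_.HasSum (f n) (s n)

/-- The hyperreal branch currents `i` and branch voltages `v` form an operating point: `i` is in
the solution space `*𝓛`, Ohm's law holds in every nonstandard branch, and Tellegen's equation
`∑ v_b s_b = 0` holds for all `s` in `*𝓛`. -/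
structure IsOperatingPoint (i v : Branch F N → HyperR F) : Prop where
  mem : i ∈ solutionSpace F N
  ohm : ∀ b, v b = r F N b * i b - e F N b
  tellegen : ∀ s ∈ solutionSpace F N, HasSum F N (fun b => v b * s b) 0

end NonstandardNetwork

/-! For one standard network, finite total isolated power says exactly that `e / r` lies in the
Hilbert space of current vectors with inner product `∑ r_b i_b s_b`. There `∑ (r_b i_b - e_b) s_b`
is the inner product of `i - e / r` with `s`, so Tellegen's equation for all `s` in the solution
space says that `i` is the orthogonal projection of `e / r` onto it. Of the loops, only the fact
that their currents generate a closed subspace is needed. Existence is `exists_tellegen`; uniqueness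
is `eq_of_tellegen_sub`, which tests with the difference of two solutions.

The nonstandard statement follows by working index by index: an operating point amounts to the
standard conditions for almost all `n` (`isOperatingPoint_induced_iff`), and an induced vector
determines its representing sequence for almost all `n` (`induced_eq_induced_iff`). -/

namespace Network

/-! ### Standard networks: the Hilbert space of finite-power currents -/

variable {ν : Rank} (N : Network.{u, v} ν)

/-- The isometry from `ℓ²` onto the Hilbert space of current vectors of finite power. -/
noncomputable def ofLp : lp (fun _ : N.Branch => ℝ) 2 →ₗ[ℝ] (N.Branch → ℝ) where
  toFun x b := x b / √(N.r b)
  map_add' x y := by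
    funext b
    simp [add_div]
  map_smul' c x := by
    funext b
    simp [mul_div_assoc]

theorem ofLp_apply (x : lp (fun _ : N.Branch => ℝ) 2) (b : N.Branch) :
    N.ofLp x b = x b / √(N.r b) := rfl

theorem sqrt_r_pos (b : N.Branch) : 0 < √(N.r b) := Real.sqrt_pos.2 (N.r_pos b)

theorem memℓp_two_iff {x : N.Branch → ℝ} : Memℓp x 2 ↔ Summable fun b => x b ^ 2 := by
  rw [memℓp_gen_iff (by norm_num)]
  simp

theorem r_mul_ofLp_mul_ofLp (x y : lp (fun _ : N.Branch => ℝ) 2) (b : N.Branch) :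
    N.r b * N.ofLp x b * N.ofLp y b = x b * y b := by
  have h := (N.sqrt_r_pos b).ne'
  nth_rewrite 1 [← Real.mul_self_sqrt (N.r_pos b).le]
  rw [ofLp_apply, ofLp_apply]
  field_simp

theorem hasSum_ofLp_mul_ofLp (x y : lp (fun _ : N.Branch => ℝ) 2) :
    HasSum (fun b => N.r b * N.ofLp x b * N.ofLp y b) (inner ℝ x y) := by
  simpa only [r_mul_ofLp_mul_ofLp, Real.inner_apply] using lp.hasSum_inner (𝕜 := ℝ) x y

theorem hasSum_ofLp_sq (x : lp (fun _ : N.Branch => ℝ) 2) :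
    HasSum (fun b => N.r b * N.ofLp x b ^ 2) (‖x‖ ^ 2) := by
  simpa [pow_two, mul_assoc] using N.hasSum_ofLp_mul_ofLp x x

theorem mem_finitePower_iff {i : N.Branch → ℝ} : i ∈ N.finitePower ↔ ∃ x, N.ofLp x = i := by
  constructor
  · intro h
    have hx : Memℓp (fun b => √(N.r b) * i b) 2 := by
      rw [memℓp_two_iff]
      simp only [mul_pow, Real.sq_sqrt (N.r_pos _).le]
      exact h
    refine ⟨⟨_, hx⟩, funext fun b => ?_⟩
    exact mul_div_cancel_left₀ _ (N.sqrt_r_pos b).ne'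
  · rintro ⟨x, rfl⟩
    exact (N.hasSum_ofLp_sq x).summable

/-- All generating loop currents have finite power, so nothing is lost when the span is pulled back
to `ℓ²`. -/
theorem loopSpan_le_range : N.loopSpan ≤ LinearMap.range N.ofLp :=
  Submodule.span_le.2 fun _ h => N.mem_finitePower_iff.1 h.1

/-- The solution space as a closed subspace of `ℓ²`. -/
noncomputable def solutionSubmodule : Submodule ℝ (lp (fun _ : N.Branch => ℝ) 2) :=
  (N.loopSpan.comap N.ofLp).topologicalClosure

theorem tsum_ofLp_sub_sq (x y : lp (fun _ : N.Branch => ℝ) 2) :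
    ∑' b, N.r b * (N.ofLp x b - N.ofLp y b) ^ 2 = ‖x - y‖ ^ 2 := by
  simpa using (N.hasSum_ofLp_sq (x - y)).tsum_eq

/-- The power of a difference is the squared `ℓ²` distance, so approximation in power and in norm
agree once `ε` is replaced by `ε ^ 2` or `√ε`. -/
theorem ofLp_mem_solutionSpace {x : lp (fun _ : N.Branch => ℝ) 2} :
    N.ofLp x ∈ N.solutionSpace ↔ x ∈ N.solutionSubmodule := by
  rw [solutionSubmodule, ← SetLike.mem_coe, Submodule.topologicalClosure_coe,
    Metric.mem_closure_iff]
  constructor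
  · rintro ⟨-, h⟩ ε hε
    obtain ⟨j, hj, hlt⟩ := h (ε ^ 2) (by positivity)
    obtain ⟨y, rfl⟩ := N.loopSpan_le_range hj
    refine ⟨y, hj, ?_⟩
    rw [tsum_ofLp_sub_sq] at hlt
    rw [dist_eq_norm]
    exact lt_of_pow_lt_pow_left₀ 2 hε.le hlt
  · refine fun h => ⟨N.mem_finitePower_iff.2 ⟨x, rfl⟩, fun ε hε => ?_⟩
    obtain ⟨y, hy, hlt⟩ := h (√ε) (Real.sqrt_pos.2 hε)
    refine ⟨N.ofLp y, hy, ?_⟩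
    rw [tsum_ofLp_sub_sq, ← Real.lt_sqrt (norm_nonneg _), ← dist_eq_norm]
    exact hlt

theorem mem_solutionSpace_iff {i : N.Branch → ℝ} :
    i ∈ N.solutionSpace ↔ ∃ x ∈ N.solutionSubmodule, N.ofLp x = i := by
  constructor
  · intro h
    obtain ⟨x, rfl⟩ := N.mem_finitePower_iff.1 h.1
    exact ⟨x, N.ofLp_mem_solutionSpace.1 h, rfl⟩
  · rintro ⟨x, hx, rfl⟩
    exact N.ofLp_mem_solutionSpace.2 hx

theorem sub_mem_solutionSpace {i j : N.Branch → ℝ} (hi : i ∈ N.solutionSpace)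
    (hj : j ∈ N.solutionSpace) : i - j ∈ N.solutionSpace := by
  obtain ⟨x, hx, rfl⟩ := N.mem_solutionSpace_iff.1 hi
  obtain ⟨y, hy, rfl⟩ := N.mem_solutionSpace_iff.1 hj
  rw [← map_sub]
  exact N.ofLp_mem_solutionSpace.2 (sub_mem hx hy)

/-- A network of finite total isolated power has an operating point: its current vector is the
orthogonal projection of `e / r` onto the solution space. -/
theorem exists_tellegen (hN : Summable fun b => N.e b ^ 2 / N.r b) :
    ∃ i ∈ N.solutionSpace, ∀ s ∈ N.solutionSpace,
      HasSum (fun b => (N.r b * i b - N.e b) * s b) 0 := by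
  have hy : Memℓp (fun b => N.e b / √(N.r b)) 2 := by
    rw [memℓp_two_iff]
    simpa only [div_pow, Real.sq_sqrt (N.r_pos _).le] using hN
  let y : lp (fun _ : N.Branch => ℝ) 2 := ⟨_, hy⟩
  -- Under the isometry, `y` corresponds to the current vector `e / r`.
  have hye : ∀ b, N.r b * N.ofLp y b = N.e b := fun b => by
    have h : N.ofLp y b = N.e b / N.r b := by
      rw [← Real.mul_self_sqrt (N.r_pos b).le, ← div_div]
      rfl
    rw [h, mul_div_cancel₀ _ (N.r_pos b).ne']
  have : CompleteSpace N.solutionSubmodule :=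
    (Submodule.isClosed_topologicalClosure _).completeSpace_coe
  refine ⟨N.ofLp (N.solutionSubmodule.starProjection y),
    N.ofLp_mem_solutionSpace.2 (Submodule.starProjection_apply_mem _ y), fun s hs => ?_⟩
  obtain ⟨z, hz, rfl⟩ := N.mem_solutionSpace_iff.1 hs
  -- The voltage is `r` times (projection minus `e / r`), the opposite sign of the residual; hence
  -- the negation.
  have h := (N.hasSum_ofLp_mul_ofLp (y - N.solutionSubmodule.starProjection y) z).neg
  rw [Submodule.starProjection_inner_eq_zero y z hz, neg_zero] at h
  refine (congrArg (HasSum · 0) (funext fun b => ?_)).mpr h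
  rw [← hye b, map_sub, Pi.sub_apply]
  ring

/-- Subtracting the two equations cancels the sources and leaves zero dissipated power for `i - j`;
since all resistances are positive, every term vanishes. -/
theorem eq_of_tellegen_sub {i j : N.Branch → ℝ}
    (hi : HasSum (fun b => (N.r b * i b - N.e b) * (i b - j b)) 0)
    (hj : HasSum (fun b => (N.r b * j b - N.e b) * (i b - j b)) 0) : i = j := by
  have h : HasSum (fun b => N.r b * (i b - j b) ^ 2) 0 := by
    rw [← sub_zero (0 : ℝ)]
    simpa only [← sub_mul, sub_sub_sub_cancel_right, ← mul_sub, mul_assoc, ← pow_two]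
      using hi.sub hj
  have h0 := (hasSum_zero_iff_of_nonneg fun b =>
    mul_nonneg (N.r_pos b).le (sq_nonneg (i b - j b))).1 h
  funext b
  have hb := congrFun h0 b
  simpa [(N.r_pos b).ne', sub_eq_zero] using hb

end Network

/-! ### Nonstandard networks: reduction to almost all indices -/

namespace NonstandardNetwork

variable {F : Ultrafilter ℕ} {ν : Rank} {N : ℕ → Network.{u, v} ν}

theorem induced_eq_induced_iff {f g : ∀ n, (N n).Branch → ℝ} :
    induced F N f = induced F N g ↔ ∀ᶠ n in (F : Filter ℕ), f n = g n := by
  constructor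
  · intro h
    -- Choose a branch where `f n` and `g n` differ, or any branch if they agree. The single
    -- nonstandard branch formed by these choices detects equality for almost all `n`.
    have hex : ∀ n, ∃ b, f n b = g n b → f n = g n := fun n => by
      by_cases hn : f n = g n
      · obtain ⟨b⟩ := (N n).branch_nonempty
        exact ⟨b, fun _ => hn⟩
      · obtain ⟨b, hb⟩ := Function.ne_iff.1 hn
        exact ⟨b, fun h' => absurd h' hb⟩
    choose b hb using hex
    have h' := Filter.Germ.coe_eq.1 (congrFun h (Quotient.mk _ b))
    exact Filter.Eventually.mono h' hb
  · intro h
    funext b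
    induction b using Quotient.inductionOn with
    | h b => exact Filter.Germ.coe_eq.2 (h.mono fun n hn => congrFun hn (b n))

theorem induced_sub (f g : ∀ n, (N n).Branch → ℝ) :
    (fun b => induced F N f b - induced F N g b) = induced F N fun n => f n - g n := by
  funext b
  induction b using Quotient.inductionOn with
  | h b => rfl

theorem induced_mul (f g : ∀ n, (N n).Branch → ℝ) :
    (fun b => induced F N f b * induced F N g b) = induced F N fun n => f n * g n := by
  funext b
  induction b using Quotient.inductionOn with
  | h b => rfl

/-- The branch voltages that Ohm's law assigns to induced branch currents. -/
theorem ohm_induced (f : ∀ n, (N n).Branch → ℝ) :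
    (fun b => r F N b * induced F N f b - e F N b) =
      induced F N fun n => (N n).r * f n - (N n).e := by
  rw [← induced_sub, ← induced_mul]
  rfl

/-- Summability does not depend on the representing sequences, because these are unique for almost
all `n`. -/
theorem hasSum_induced_zero_iff {f : ∀ n, (N n).Branch → ℝ} :
    HasSum F N (induced F N f) 0 ↔ ∀ᶠ n in (F : Filter ℕ), _root_.HasSum (f n) 0 := by
  constructor
  · rintro ⟨g, s, hfg, hs, hg⟩
    filter_upwards [induced_eq_induced_iff.1 hfg, Filter.Germ.coe_eq.1 hs, hg] with n h1 h2 h3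
    rw [h1, show (0 : ℝ) = s n from h2]
    exact h3
  · exact fun h => ⟨f, fun _ => 0, rfl, rfl, h⟩

/-- The exceptional set of indices in Tellegen's equation may depend on `s`. This is harmless for
uniqueness, where one sequence of test currents suffices. -/
theorem isOperatingPoint_induced_iff {f : ∀ n, (N n).Branch → ℝ} {v : Branch F N → HyperR F} :
    IsOperatingPoint F N (induced F N f) v ↔
      induced F N f ∈ solutionSpace F N ∧
      v = (induced F N fun n => (N n).r * f n - (N n).e) ∧
      ∀ s : ∀ n, (N n).Branch → ℝ, (∀ᶠ n in (F : Filter ℕ), s n ∈ (N n).solutionSpace) →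
        ∀ᶠ n in (F : Filter ℕ), _root_.HasSum (((N n).r * f n - (N n).e) * s n) 0 := by
  constructor
  · rintro ⟨hmem, hohm, htel⟩
    have hv : v = induced F N fun n => (N n).r * f n - (N n).e :=
      (funext hohm).trans (ohm_induced f)
    refine ⟨hmem, hv, fun s hs => ?_⟩
    rw [← hasSum_induced_zero_iff, ← induced_mul, ← hv]
    exact htel _ ⟨s, hs, rfl⟩
  · rintro ⟨hmem, rfl, htel⟩
    refine ⟨hmem, fun b => (congrFun (ohm_induced f) b).symm, ?_⟩
    rintro _ ⟨s, hs, rfl⟩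
    rw [induced_mul, hasSum_induced_zero_iff]
    exact htel s hs

end NonstandardNetwork

theorem mainTheorem1 (F : Ultrafilter ℕ) (hF : (F : Filter ℕ) ≤ Filter.cofinite)
    (ν : Rank) (hν : 1 ≤ ν) (N : ℕ → Network.{u, v} ν)
    (hpower : ∀ᶠ n in (F : Filter ℕ), Summable fun b => (N n).e b ^ 2 / (N n).r b) :
    ∃! p : (NonstandardNetwork.Branch F N → HyperR F) × (NonstandardNetwork.Branch F N → HyperR F),
      NonstandardNetwork.IsOperatingPoint F N p.1 p.2 := by
  open NonstandardNetwork in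
  have hex : ∀ n, ∃ i : (N n).Branch → ℝ, (Summable fun b => (N n).e b ^ 2 / (N n).r b) →
      i ∈ (N n).solutionSpace ∧ ∀ s ∈ (N n).solutionSpace,
        _root_.HasSum (fun b => ((N n).r b * i b - (N n).e b) * s b) 0 := fun n => by
    by_cases hn : Summable fun b => (N n).e b ^ 2 / (N n).r b
    · obtain ⟨i, hi⟩ := (N n).exists_tellegen hn
      exact ⟨i, fun _ => hi⟩
    · exact ⟨0, fun h => absurd h hn⟩
  choose i hi using hex
  have hi' := hpower.mono fun n hn => hi n hn
  have hpoint := isOperatingPoint_induced_iff.2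
    ⟨⟨i, hi'.mono fun n hn => hn.1, rfl⟩, rfl, fun s hs => by
      filter_upwards [hi', hs] with n hn hsn using hn.2 _ hsn⟩
  refine ⟨(induced F N i, _), hpoint, ?_⟩
  rintro ⟨j', v⟩ hj
  obtain ⟨j, hjmem, rfl⟩ := hj.mem
  obtain ⟨-, hv, htel⟩ := isOperatingPoint_induced_iff.1 hj
  have heq : ∀ᶠ n in (F : Filter ℕ), j n = i n := by
    -- The difference of the two currents is an admissible test vector in both Tellegen equations.
    have hd : ∀ᶠ n in (F : Filter ℕ), j n - i n ∈ (N n).solutionSpace := by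
      filter_upwards [hi', hjmem] with n hn hjn using (N n).sub_mem_solutionSpace hjn hn.1
    filter_upwards [hi', htel _ hd, hd] with n hn hjn hdn
    exact (N n).eq_of_tellegen_sub hjn (hn.2 _ hdn)
  refine Prod.ext (induced_eq_induced_iff.2 heq) (hv.trans (induced_eq_induced_iff.2 ?_))
  exact heq.mono fun n hn => by rw [hn]
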